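/- For totally ordered sets $X,Y$ and an integer $p\ge 1$, a kernel $K:X\times Y\to\mathbb R$ is called $\mathrm{TN}_p$ (respectively $\mathrm{TP}_p$) if $\det (K(x_j,y_k))_{j,k=1}^r\ge 0$ (respectively $>0$) for all integers $1\le r\le p$ and all $x_1<\dots<x_r$ in $X$, $y_1<\dots<y_r$ in $Y$; it is $\mathrm{TN}$ if it is $\mathrm{TN}_p$ for every $p\ge 1$. For $X\subseteq\mathbb R$, a kernel $K:X\times X\to\mathbb R$ is Hankel if there is a function $f:X+X\to\mathbb R$ with $K(x,y)=f(x+y)$ for all $x,y\in X$. Powers of kernels are taken pointwise, with the convention $0^0:=0$. Let $p\ge 2$ be an integer, let $c_0,u_0>0$ with $u_0\ne 1$, let $\alpha\ge 0$ be real, and let $X_0\subseteq\mathbb R$ be an interval of positive measure. Put $H_{u_0}(x,y)=1+c_0u_0^{x+y}$ for $x,y\in X_0$. The following are equivalent: 1. For every interval $X\subseteq\mathbb R$ of positive measure and every continuous $\mathrm{TN}_p$ Hankel kernel $H:X\times X\to\mathbb R$, the power $H^\alpha$ is $\mathrm{TN}_p$. 2. The power $H_{u_0}^\alpha$ is $\mathrm{TN}_p$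 on $X_0\times X_0$. 3. $\alpha\in\mathbb Z_{\ge 0}\cup[p-2,\infty)$. In particular, for every integer $n\ge 0$, every interval $X\subseteq\mathbb R$ of positive measure and every continuous $\mathrm{TN}$ Hankel kernel $H:X\times X\to\mathbb R$, the power $H^n$ is $\mathrm{TN}$. Moreover, for all $x_1<\dots<x_p$ and $y_1<\dots<y_p$ in $X_0$, the matrix $\big(H_{u_0}(x_j,y_k)^\alpha\big)_{j,k=1}^p$ is $\mathrm{TP}_p$ if $\alpha>p-2$, and is not $\mathrm{TN}_p$ if $\alpha\in(0,p-2)\setminus\mathbb Z$. -/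

import Mathlib

/-- A kernel `K : X × Y → ℝ` on totally ordered sets is totally non-negative of order `p`:
all minors of sizes `1 ≤ r ≤ p` drawn at increasing tuples are non-negative. -/
def IsTNOrder {X Y : Type*} [LinearOrder X] [LinearOrder Y] (p : ℕ) (K : X → Y → ℝ) : Prop :=
  ∀ r : ℕ, 1 ≤ r → r ≤ p → ∀ x : Fin r → X, StrictMono x → ∀ y : Fin r → Y, StrictMono y →
    0 ≤ (Matrix.of fun j k => K (x j) (y k)).det

/-- A kernel is totally positive of order `p`: all these minors are positive. -/
def IsTPOrder {X Y : Type*} [LinearOrder X] [LinearOrder Y] (p : ℕ) (K : X → Y → ℝ) : Prop :=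
  ∀ r : ℕ, 1 ≤ r → r ≤ p → ∀ x : Fin r → X, StrictMono x → ∀ y : Fin r → Y, StrictMono y →
    0 < (Matrix.of fun j k => K (x j) (y k)).det

/-- A kernel is totally non-negative: it is so of every order. -/
def IsTN {X Y : Type*} [LinearOrder X] [LinearOrder Y] (K : X → Y → ℝ) : Prop :=
  ∀ p : ℕ, 1 ≤ p → IsTNOrder p K

/-- Hankel kernels on `X × X`: `K(x,y) = f(x+y)`. Only the values of `f` on `X + X` matter. -/
def IsHankel {X : Set ℝ} (K : X → X → ℝ) : Prop :=
  ∃ f : ℝ → ℝ, ∀ x y : X, K x y = f ((x : ℝ) + (y : ℝ))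

/-- An interval of positive (possibly infinite) Lebesgue measure. -/
def IsPosInterval (X : Set ℝ) : Prop :=
  X.OrdConnected ∧ 0 < MeasureTheory.volume X

/-- The power `K ^ α` of a kernel with non-negative values, for `α ≥ 0`, with the convention
`0 ^ 0 = 0` (whereas `Real.rpow` has `0 ^ 0 = 1`). -/
noncomputable def kernelPow {X Y : Type*} (K : X → Y → ℝ) (α : ℝ) : X → Y → ℝ :=
  fun x y => if K x y = 0 then 0 else K x y ^ α

/-- The Hankel kernel `1 + c₀ u₀ ^ (x + y)` on `X × X`. -/
noncomputable def expHankel (c₀ u₀ : ℝ) (X : Set ℝ) : X → X → ℝ :=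
  fun x y => 1 + c₀ * u₀ ^ ((x : ℝ) + (y : ℝ))

/-! For a continuous Hankel kernel on an interval, `TN_p` is equivalent to positive semidefiniteness
of all principal submatrices of order at most `p`. One direction is the principal minor criterion.
For the other, restrict to a grid of mesh `1/N`: the kernel becomes a Hankel matrix, whose
contiguous minors are again principal minors at (half-)grid points. After a positive definite
perturbation these are positive, Fekete's criterion makes all minors positive, and two limits remove
the perturbation and the grid (`det_hankel_nonneg`, `IsHankel.isTNOrder_of_posSemidef`).

Preservation of `TN_p` under powers thereby reduces to matrices: integer powers preserve
semidefiniteness by the Schur product theorem, and powers `α ≥ p - 2` do so for positive entries by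
FitzGerald–Horn. Kernels with a zero vanish identically.

Sharpness comes from one sign formula (`Matrix.exists_det_one_add_mul_rpow_eq`): for increasing
positive `a`, `b`, every minor of order `n + 1` of `(1 + a_j b_k) ^ α` is a positive multiple of
`∏_{i<n} (α - i)^(n-i)`. -/

/-! ### Fekete's criterion: positivity of all minors from contiguous ones -/

/-- Scale each row to make the first column constantly 1, subtract from each row its predecessor,
and expand along the first column. -/
theorem Matrix.det_eq_prod_mul_det_sub {n : ℕ} (M : Matrix (Fin (n + 1)) (Fin (n + 1)) ℝ)
    (h : ∀ i, M i 0 ≠ 0) :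
    M.det = (∏ i, M i 0) * (Matrix.of fun i k : Fin n =>
      M i.succ k.succ / M i.succ 0 - M i.castSucc k.succ / M i.castSucc 0).det := by
  have h1 : M = Matrix.of fun i k => M i 0 * (Matrix.of fun i k => M i k / M i 0) i k := by
    ext i k
    simp only [Matrix.of_apply]
    field_simp [h i]
  rw [h1, Matrix.det_mul_column, ← h1]
  congr 1
  set B : Matrix (Fin (n + 1)) (Fin (n + 1)) ℝ := Matrix.of fun i k =>
    Fin.cases (M 0 k / M 0 0)
      (fun i => M i.succ k / M i.succ 0 - M i.castSucc k / M i.castSucc 0) i with hB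
  rw [Matrix.det_eq_of_forall_row_eq_smul_add_pred (B := B) (fun _ => 1)]
  · rw [Matrix.det_succ_column_zero, Fin.sum_univ_succ]
    have : ∀ i : Fin n, B i.succ 0 = 0 := by
      intro i
      simp [hB, h]
    simp only [this]
    simp [hB, h]
    rfl
  · intro j; simp [hB]
  · intro i j; simp [hB]

/-- The order drops by one on passing to differences of consecutive normalised rows. A difference of
distant rows telescopes into consecutive ones, so by multilinearity a general minor is a positive
factor times a sum of smaller minors of the difference matrix. -/
theorem Matrix.det_pos_of_consecutive_rows (n : ℕ) : ∀ (A : ℕ → ℕ → ℝ) (N : ℕ),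
    (∀ r ≤ n, ∀ i, i + r ≤ N → 0 < (Matrix.of fun a b : Fin r => A (i + a) b).det) →
    ∀ I : Fin n → ℕ, StrictMono I → (∀ a, I a < N) →
      0 < (Matrix.of fun a b : Fin n => A (I a) b).det := by
  induction n with
  | zero => intro A N _ I _ _; simp
  | succ n ih =>
    intro A N h I hI hN
    obtain ⟨N, rfl⟩ : ∃ N', N = N' + 1 := ⟨N - 1, by have := hN 0; omega⟩
    have h0 : ∀ i, i < N + 1 → 0 < A i 0 := by
      intro i hi
      simpa using h 1 (by omega) i (by omega)
    set A' : ℕ → ℕ → ℝ := fun i k => A (i + 1) (k + 1) / A (i + 1) 0 - A i (k + 1) / A i 0 with hA'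
    have key : ∀ r ≤ n, ∀ i, i + r ≤ N →
        0 < (Matrix.of fun a b : Fin r => A' (i + a) b).det := by
      intro r hr i hi
      have h1 := h (r + 1) (by omega) i (by omega)
      have h2 : ∀ a : Fin (r + 1), 0 < A (i + a) 0 := fun a => h0 _ (by omega)
      rw [Matrix.det_eq_prod_mul_det_sub _ (fun a => by simpa using (h2 a).ne')] at h1
      have h3 := pos_of_mul_pos_right h1 (Finset.prod_nonneg fun a _ => by simpa using (h2 a).le)
      simpa [hA', add_assoc] using h3
    rw [Matrix.det_eq_prod_mul_det_sub _ (fun a => by simpa using (h0 _ (hN a)).ne')]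
    refine mul_pos (Finset.prod_pos fun a _ => by simpa using h0 _ (hN a)) ?_
    have hlt : ∀ i : Fin n, I i.castSucc < I i.succ := fun i => hI i.castSucc_lt_succ
    have htel : (Matrix.of fun i k : Fin n => A (I i.succ) (k.succ : Fin (n + 1)) / A (I i.succ) 0 -
        A (I i.castSucc) (k.succ : Fin (n + 1)) / A (I i.castSucc) 0).det =
        Matrix.detRowAlternating.toMultilinearMap (fun i : Fin n =>
          ∑ l ∈ Finset.Ico (I i.castSucc) (I i.succ), fun k : Fin n => A' l k) := by
      congr 1
      ext i k
      simp only [Matrix.of_apply, Finset.sum_apply, hA', Fin.val_succ]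
      rw [Finset.sum_Ico_eq_sub _ (hlt i).le,
        Finset.sum_range_sub (fun l => A l (k + 1) / A l 0),
        Finset.sum_range_sub (fun l => A l (k + 1) / A l 0)]
      ring
    have goal' := htel.trans (MultilinearMap.map_sum_finset
      (Matrix.detRowAlternating (R := ℝ) (n := Fin n)).toMultilinearMap
      (fun (_ : Fin n) (l : ℕ) => (fun k : Fin n => A' l k))
      (fun i => Finset.Ico (I i.castSucc) (I i.succ)))
    simp only [Matrix.of_apply, Fin.val_zero]
    rw [goal']
    refine Finset.sum_pos (fun r hr => ?_) ?_
    · rw [Fintype.mem_piFinset] at hr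
      simp only [Finset.mem_Ico] at hr
      refine ih A' N key r ?_ ?_
      · intro i j hij
        -- The blocks `[I i, I (i+1))` are disjoint and ordered, so any choice of one row from each
        -- is increasing.
        have h1 : i.succ ≤ j.castSucc := by
          rw [Fin.le_def]; simpa using hij
        exact (hr i).2.trans_le ((hI.monotone h1).trans (hr j).1)
      · intro a
        have := (hr a).2
        have := hN a.succ
        omega
    · rw [Fintype.piFinset_nonempty]
      intro i
      simpa using hlt i

theorem Matrix.det_pos_of_consecutive {p N₁ N₂ : ℕ} (A : ℕ → ℕ → ℝ)
    (h : ∀ r ≤ p, ∀ i j, i + r ≤ N₁ → j + r ≤ N₂ →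
      0 < (Matrix.of fun a b : Fin r => A (i + a) (j + b)).det)
    (r : ℕ) (hr : r ≤ p) (I J : Fin r → ℕ) (hI : StrictMono I) (hJ : StrictMono J)
    (hI' : ∀ a, I a < N₁) (hJ' : ∀ a, J a < N₂) :
    0 < (Matrix.of fun a b : Fin r => A (I a) (J b)).det := by
  have h1 : ∀ q ≤ p, ∀ j, j + q ≤ N₂ → ∀ I : Fin q → ℕ, StrictMono I → (∀ a, I a < N₁) →
      0 < (Matrix.of fun a b : Fin q => A (I a) (j + b)).det := by
    intro q hq j hj I hI hI'
    exact Matrix.det_pos_of_consecutive_rows q (fun i b => A i (j + b)) N₁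
      (fun r hr i hi => h r (hr.trans hq) i j hi (by omega)) I hI hI'
  have h2 := Matrix.det_pos_of_consecutive_rows r
    -- The row criterion is now applied to the transpose; the value 0 is a filler outside the minor.
    (fun l a => if ha : a < r then A (I ⟨a, ha⟩) l else 0) N₂ (fun q hq j hj => ?_) J hJ hJ'
  · rw [← Matrix.det_transpose]
    convert h2 using 2
    ext a b
    simp
  · have h3 := h1 q (hq.trans hr) j hj (fun a => I (a.castLE hq))
      (hI.comp (Fin.strictMono_castLE hq)) (fun a => hI' _)
    rw [← Matrix.det_transpose] at h3
    convert h3 using 2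
    ext a b
    have : (b : ℕ) < r := b.2.trans_le hq
    simp [this]
    rfl

/-! ### The sign of the minors of `(1 + a b) ^ α` -/

/-- With the other slots frozen, `f` is a linear functional of one slot, so the scalar mean value
theorem applies; the slots are treated one at a time. -/
theorem MultilinearMap.exists_map_sub_eq_prod_mul {ι : Type*} [Fintype ι] [DecidableEq ι] {m : ℕ}
    (f : MultilinearMap ℝ (fun _ : ι => Fin m → ℝ) ℝ) (γ γ' : ℝ → Fin m → ℝ) (a b : ι → ℝ)
    (hab : ∀ i, a i < b i)
    (hγ : ∀ i, ∀ t ∈ Set.Icc (a i) (b i), HasDerivAt γ (γ' t) t) :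
    ∃ ξ : ι → ℝ, (∀ i, ξ i ∈ Set.Ioo (a i) (b i)) ∧
      f (fun i => γ (b i) - γ (a i)) = (∏ i, (b i - a i)) * f (fun i => γ' (ξ i)) := by
  suffices H : ∀ s : Finset ι, ∃ ξ : ι → ℝ, (∀ i ∈ s, ξ i ∈ Set.Ioo (a i) (b i)) ∧
      f (fun i => γ (b i) - γ (a i)) = (∏ i ∈ s, (b i - a i)) *
        f (fun i => if i ∈ s then γ' (ξ i) else γ (b i) - γ (a i)) by
    obtain ⟨ξ, h1, h2⟩ := H Finset.univ
    exact ⟨ξ, fun i => h1 i (Finset.mem_univ i), by simpa using h2⟩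
  intro s
  induction s using Finset.induction with
  | empty => exact ⟨a, by simp, by simp⟩
  | insert j s hj ih =>
    obtain ⟨ξ, h1, h2⟩ := ih
    set v : ι → Fin m → ℝ := fun i => if i ∈ s then γ' (ξ i) else γ (b i) - γ (a i) with hv
    set L : (Fin m → ℝ) →L[ℝ] ℝ := (f.toLinearMap v j).toContinuousLinearMap with hL
    have hd : ∀ t ∈ Set.Icc (a j) (b j), HasDerivAt (fun t => L (γ t)) (L (γ' t)) t :=
      fun t ht => L.hasFDerivAt.comp_hasDerivAt t (hγ j t ht)
    obtain ⟨c, hc, hc'⟩ := exists_hasDerivAt_eq_slope (fun t => L (γ t)) (fun t => L (γ' t)) (hab j)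
      (fun t ht => (hd t ht).continuousAt.continuousWithinAt)
      (fun t ht => hd t (Set.Ioo_subset_Icc_self ht))
    refine ⟨Function.update ξ j c, ?_, ?_⟩
    · intro i hi
      rcases eq_or_ne i j with rfl | hij
      · simpa using hc
      · rw [Function.update_of_ne hij]
        exact h1 i (Finset.mem_of_mem_insert_of_ne hi hij)
    · rw [h2, Finset.prod_insert hj]
      have hv1 : v = Function.update v j (γ (b j) - γ (a j)) := by
        ext1 i
        rcases eq_or_ne i j with rfl | hij
        · simp [hv, hj]
        · simp [hij]
      have hv2 : (fun i => if i ∈ insert j s then γ' (Function.update ξ j c i)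
          else γ (b i) - γ (a i)) = Function.update v j (γ' c) := by
        ext1 i
        rcases eq_or_ne i j with rfl | hij
        · simp
        · simp [hv, hij]
      have hL1 : ∀ w, L w = f (Function.update v j w) := fun w => rfl
      have h3 : L (γ (b j) - γ (a j)) = (b j - a j) * L (γ' c) := by
        rw [hc', map_sub]
        field_simp [(sub_pos.2 (hab j)).ne']
      rw [hv2, ← hL1, hv1, ← hL1, h3]
      ring

/-- The sign of the minors of `(1 + a b) ^ α`. -/
theorem Matrix.exists_det_one_add_mul_rpow_eq (n : ℕ) : ∀ (α : ℝ) (a b : Fin (n + 1) → ℝ),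
    StrictMono a → StrictMono b → (∀ i, 0 < a i) → (∀ i, 0 < b i) →
    ∃ C : ℝ, 0 < C ∧ (Matrix.of fun j k => (1 + a j * b k) ^ α).det =
      C * ∏ i ∈ Finset.range n, (α - i) ^ (n - i) := by
  induction n with
  | zero =>
    intro α a b _ _ ha hb
    refine ⟨(1 + a 0 * b 0) ^ α, ?_, by simp⟩
    have := mul_pos (ha 0) (hb 0)
    positivity
  | succ n ih =>
    intro α a b ha hb ha0 hb0
    have hpos : ∀ {x y : ℝ}, 0 < x → 0 < y → 0 < 1 + x * y := fun hx hy => by positivity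
    set γ : ℝ → Fin (n + 1) → ℝ := fun x k => (1 + x * b k.succ) ^ α / (1 + x * b 0) ^ α with hγ
    -- By `b_k (1 + x b_0) - b_0 (1 + x b_k) = b_k - b_0`, the derivative is a row factor times a
    -- column factor times the same kernel with exponent `α - 1`.
    set γ' : ℝ → Fin (n + 1) → ℝ := fun x k => (α * (1 + x * b 0) ^ (-α - 1)) *
      ((b k.succ - b 0) * (1 + x * b k.succ) ^ (α - 1)) with hγ'
    have hd : ∀ x, 0 < x → HasDerivAt γ (γ' x) x := by
      intro x hx
      rw [hasDerivAt_pi]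
      intro k
      have h1 : ∀ c, 0 < c → HasDerivAt (fun x => (1 + x * c) ^ α)
          (c * α * (1 + x * c) ^ (α - 1)) x := by
        intro c hc
        have : HasDerivAt (fun x => 1 + x * c) c x := by
          simpa using ((hasDerivAt_id x).mul_const c).const_add 1
        exact this.rpow_const (Or.inl (hpos hx hc).ne')
      have h2 := (h1 _ (hb0 k.succ)).div (h1 _ (hb0 0))
        (Real.rpow_pos_of_pos (hpos hx (hb0 0)) α).ne'
      refine h2.congr_deriv ?_
      have hp := hpos hx (hb0 0)
      have hq := hpos hx (hb0 k.succ)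
      simp only [hγ']
      rw [Real.rpow_sub_one hp.ne', Real.rpow_sub_one hp.ne', Real.rpow_sub_one hq.ne',
        Real.rpow_neg hp.le]
      have hp' := Real.rpow_pos_of_pos hp α
      have hq' := Real.rpow_pos_of_pos hq α
      generalize (1 + x * b 0) ^ α = P at hp' ⊢
      generalize (1 + x * b k.succ) ^ α = Q at hq' ⊢
      generalize hu : 1 + x * b 0 = u at hp ⊢
      generalize hw : 1 + x * b k.succ = w at hq ⊢
      field_simp
      rw [← hu, ← hw]
      ring
    obtain ⟨ξ, hξ, hξ'⟩ := MultilinearMap.exists_map_sub_eq_prod_mul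
      (Matrix.detRowAlternating (R := ℝ) (n := Fin (n + 1))).toMultilinearMap γ γ'
      (fun i => a i.castSucc) (fun i => a i.succ) (fun i => ha i.castSucc_lt_succ)
      (fun i t ht => hd t ((ha0 _).trans_le ht.1))
    have hξ0 : ∀ i, 0 < ξ i := fun i => (ha0 _).trans (hξ i).1
    -- The mean value points interlace with `a`.
    have hξm : StrictMono ξ := by
      refine Fin.strictMono_iff_lt_succ.2 fun i => ?_
      exact (hξ i.castSucc).2.trans (by simpa using (hξ i.succ).1)
    obtain ⟨C, hC, hC'⟩ := ih (α - 1) ξ (fun k => b k.succ) hξm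
      (fun i j hij => hb (Fin.succ_lt_succ_iff.2 hij)) hξ0 (fun k => hb0 _)
    have hrow : ∀ j, 0 < 1 + a j * b 0 := fun j => hpos (ha0 j) (hb0 0)
    rw [Matrix.det_eq_prod_mul_det_sub _ fun j => by
      simpa using (Real.rpow_pos_of_pos (hrow j) α).ne']
    have e1 : (Matrix.of fun i k : Fin (n + 1) => γ' (ξ i) k).det =
        (∏ j, (α * (1 + ξ j * b 0) ^ (-α - 1))) * ((∏ k : Fin (n + 1), (b k.succ - b 0)) *
          (Matrix.of fun j k : Fin (n + 1) => (1 + ξ j * b k.succ) ^ (α - 1)).det) := by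
      rw [← Matrix.det_mul_row, ← Matrix.det_mul_column]
      rfl
    have e2 : (Matrix.of fun i k : Fin (n + 1) =>
        (1 + a i.succ * b k.succ) ^ α / (1 + a i.succ * b 0) ^ α -
        (1 + a i.castSucc * b k.succ) ^ α / (1 + a i.castSucc * b 0) ^ α).det =
        (∏ i : Fin (n + 1), (a i.succ - a i.castSucc)) *
          (Matrix.of fun i k : Fin (n + 1) => γ' (ξ i) k).det := hξ'
    simp only [Matrix.of_apply]
    rw [e2, e1, hC', Finset.prod_mul_distrib, Finset.prod_range_succ']
    refine ⟨(∏ j, (1 + a j * b 0) ^ α) * (∏ i : Fin (n + 1), (a i.succ - a i.castSucc)) *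
      (∏ j, (1 + ξ j * b 0) ^ (-α - 1)) * (∏ k : Fin (n + 1), (b k.succ - b 0)) * C, ?_, ?_⟩
    · have p1 : 0 < ∏ j, (1 + a j * b 0) ^ α :=
        Finset.prod_pos fun j _ => Real.rpow_pos_of_pos (hrow j) _
      have p2 : 0 < ∏ i : Fin (n + 1), (a i.succ - a i.castSucc) :=
        Finset.prod_pos fun i _ => sub_pos.2 (ha i.castSucc_lt_succ)
      have p3 : 0 < ∏ j, (1 + ξ j * b 0) ^ (-α - 1) :=
        Finset.prod_pos fun j _ => Real.rpow_pos_of_pos (hpos (hξ0 j) (hb0 0)) _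
      have p4 : 0 < ∏ k : Fin (n + 1), (b k.succ - b 0) :=
        Finset.prod_pos fun k _ => sub_pos.2 (hb (Fin.succ_pos k))
      positivity
    · have : ∀ i : ℕ, α - 1 - i = α - ((i + 1 : ℕ) : ℝ) := fun i => by push_cast; ring
      simp only [this, Nat.add_sub_add_right]
      simp
      ring

/-! ### Positive semidefiniteness from principal minors -/

theorem Matrix.det_add_diagonal_single {n : ℕ} (A : Matrix (Fin (n + 1)) (Fin (n + 1)) ℝ)
    (i : Fin (n + 1)) (t : ℝ) :
    (A + Matrix.diagonal (Pi.single i t)).det =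
      A.det + t * (A.submatrix i.succAbove i.succAbove).det := by
  have h : A + Matrix.diagonal (Pi.single i t) =
      A.updateRow i (A i + t • Pi.single i (1 : ℝ)) := by
    ext a b
    rcases eq_or_ne a i with rfl | ha
    · rcases eq_or_ne b a with rfl | hb
      · simp
      · simp [hb, hb.symm, Matrix.diagonal_apply_ne]
    · rw [Matrix.updateRow_ne ha]
      rcases eq_or_ne a b with rfl | hb
      · simp [ha]
      · simp [hb]
  rw [h, Matrix.det_updateRow_add, Matrix.updateRow_eq_self, Matrix.det_updateRow_smul,
    ← Matrix.adjugate_apply, Matrix.adjugate_fin_succ_eq_det_submatrix]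
  simp [← two_mul]

theorem Matrix.det_add_smul_one_pos {n : ℕ} (A : Matrix (Fin n) (Fin n) ℝ)
    (h : ∀ (k : ℕ) (e : Fin k → Fin n), Function.Injective e → 0 ≤ (A.submatrix e e).det)
    {t : ℝ} (ht : 0 < t) : 0 < (A + t • (1 : Matrix (Fin n) (Fin n) ℝ)).det := by
  -- Raise the diagonal entries one at a time: each step adds `t` times a smaller principal minor.
  -- Strictness starts from the empty minor, which is 1.
  suffices H : ∀ T : Finset (Fin n), ∀ (k : ℕ) (e : Fin k → Fin n), Function.Injective e →
      0 ≤ ((A + Matrix.diagonal (fun i => if i ∈ T then t else 0)).submatrix e e).det ∧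
      ((∀ a, e a ∈ T) →
        0 < ((A + Matrix.diagonal (fun i => if i ∈ T then t else 0)).submatrix e e).det) by
    have := (H Finset.univ n id Function.injective_id).2 (by simp)
    simpa [Matrix.smul_one_eq_diagonal] using this
  intro T
  induction T using Finset.induction with
  | empty =>
    intro k e he
    refine ⟨by simpa using h k e he, fun hT => ?_⟩
    obtain rfl : k = 0 := by
      by_contra hk
      simpa using hT ⟨0, Nat.pos_of_ne_zero hk⟩
    simp
  | insert i T hi ih =>
    intro k e he
    set B := A + Matrix.diagonal (fun j => if j ∈ T then t else 0) with hB
    have hins : A + Matrix.diagonal (fun j => if j ∈ insert i T then t else 0) =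
        B + Matrix.diagonal (Pi.single i t) := by
      rw [hB, add_assoc, Matrix.diagonal_add]
      congr 2
      ext j
      rcases eq_or_ne j i with rfl | hj
      · simp [hi]
      · simp [hj]
    rw [hins]
    by_cases hie : ∃ a, e a = i
    · obtain ⟨a, rfl⟩ := hie
      obtain ⟨k, rfl⟩ : ∃ k', k = k' + 1 := ⟨k - 1, by have := a.2; omega⟩
      have hsub : (B + Matrix.diagonal (Pi.single (e a) t)).submatrix e e =
          B.submatrix e e + Matrix.diagonal (Pi.single a t) := by
        ext b c
        simp only [Matrix.submatrix_apply, Matrix.add_apply, Matrix.diagonal_apply, he.eq_iff,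
          Pi.single_apply]
      rw [hsub, Matrix.det_add_diagonal_single, Matrix.submatrix_submatrix]
      have hinj : Function.Injective (e ∘ a.succAbove) := he.comp Fin.succAbove_right_injective
      refine ⟨add_nonneg (ih _ e he).1 (mul_nonneg ht.le (ih _ _ hinj).1), fun hT => ?_⟩
      refine add_pos_of_nonneg_of_pos (ih _ e he).1 (mul_pos ht ((ih _ _ hinj).2 fun b => ?_))
      refine Finset.mem_of_mem_insert_of_ne (hT _) fun hb => ?_
      exact Fin.succAbove_ne a b (he hb)
    · push Not at hie
      have hsub : (B + Matrix.diagonal (Pi.single i t)).submatrix e e = B.submatrix e e := by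
        ext b c
        simp [Matrix.diagonal_apply, hie]
      rw [hsub]
      exact ⟨(ih k e he).1, fun hT => (ih k e he).2 fun a =>
        Finset.mem_of_mem_insert_of_ne (hT a) (hie a)⟩

theorem Matrix.posSemidef_of_principal_minors_nonneg {n : ℕ} (A : Matrix (Fin n) (Fin n) ℝ)
    (hA : A.IsHermitian)
    (h : ∀ (k : ℕ) (e : Fin k → Fin n), StrictMono e → 0 ≤ (A.submatrix e e).det) :
    A.PosSemidef := by
  have h' : ∀ (k : ℕ) (e : Fin k → Fin n), Function.Injective e → 0 ≤ (A.submatrix e e).det := by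
    intro k e he
    have hs := (Tuple.monotone_sort e).strictMono_of_injective
      (he.comp (Tuple.sort e).injective)
    have := h k _ hs
    rwa [← Matrix.submatrix_submatrix, Matrix.det_submatrix_equiv_self] at this
  rw [hA.posSemidef_iff_eigenvalues_nonneg]
  intro i
  by_contra! hi
  -- For an eigenvalue `λ < 0` the matrix `A - λ` is singular, yet its determinant would be
  -- positive.
  have hpos := A.det_add_smul_one_pos h' (neg_pos.2 hi)
  refine hpos.ne' (Matrix.exists_mulVec_eq_zero_iff.1
    ⟨hA.eigenvectorBasis i, ?_, ?_⟩)
  · intro h0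
    exact hA.eigenvectorBasis.orthonormal.ne_zero i (by ext j; exact congrFun h0 j)
  · rw [Matrix.add_mulVec, hA.mulVec_eigenvectorBasis, Matrix.smul_mulVec, Matrix.one_mulVec]
    simp

/-! ### Entrywise powers of positive semidefinite matrices -/

theorem Matrix.PosSemidef.schur_complement_zero {n : ℕ} {A : Matrix (Fin (n + 1)) (Fin (n + 1)) ℝ}
    (hA : A.PosSemidef) (h0 : A 0 0 ≠ 0) :
    (Matrix.of fun i j => A i j - A i 0 * A 0 j / A 0 0).PosSemidef := by
  have hs : ∀ i j, A i j = A j i := fun i j => by simpa using (hA.1.apply i j).symm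
  have := hA.conjTranspose_mul_mul_same
    (Matrix.of fun k l : Fin (n + 1) => (if k = l then 1 else 0) - if k = 0 then A 0 l / A 0 0 else 0)
  convert this using 1
  ext i j
  simp only [Matrix.mul_apply, Matrix.of_apply, Matrix.conjTranspose_apply, star_trivial, sub_mul,
    mul_sub, Finset.sum_sub_distrib, ite_mul, mul_ite, one_mul, mul_one, zero_mul, mul_zero,
    Finset.sum_ite_eq', Finset.mem_univ, if_true]
  rw [hs 0 i]
  field_simp
  ring

/-- **FitzGerald–Horn**: entrywise powers `α ≥ n - 2` preserve positive semidefiniteness of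
`n × n` matrices with positive entries. -/
theorem Matrix.PosSemidef.map_rpow (m : ℕ) : ∀ (α : ℝ), (m : ℝ) - 1 ≤ α →
    ∀ A : Matrix (Fin (m + 1)) (Fin (m + 1)) ℝ, A.PosSemidef → (∀ i j, 0 < A i j) →
      (A.map (· ^ α)).PosSemidef := by
  induction m with
  -- For order 1 the bound is only `α ≥ -1`, as the induction lowers `α` by one together with the
  -- order.
  | zero =>
    intro α _ A _ hA0
    have : A.map (· ^ α) = Matrix.diagonal (fun i => A i i ^ α) := by
      ext i j
      obtain rfl : i = j := Fin.ext (by omega)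
      simp
    rw [this]
    exact Matrix.PosSemidef.diagonal fun i => (Real.rpow_pos_of_pos (hA0 i i) α).le
  | succ m ih =>
    intro α hα A hA hA0
    have hs : ∀ i j, A i j = A j i := fun i j => by simpa using (hA.1.apply i j).symm
    have hα0 : 0 ≤ α := le_trans (by push_cast; simp) hα
    have hB := hA.schur_complement_zero (hA0 0 0).ne'
    set B : Matrix (Fin (m + 1 + 1)) (Fin (m + 1 + 1)) ℝ :=
      Matrix.of fun i j => A i j - A i 0 * A 0 j / A 0 0 with hBdef
    set Z : Matrix (Fin (m + 1 + 1)) (Fin (m + 1 + 1)) ℝ :=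
      Matrix.of fun i j => A i 0 * A 0 j / A 0 0 with hZdef
    have hZ0 : ∀ i j, 0 < Z i j := fun i j => div_pos (mul_pos (hA0 _ _) (hA0 _ _)) (hA0 0 0)
    have hZ : Z.PosSemidef := by
      have := (Matrix.posSemidef_vecMulVec_self_star (fun i => A i 0)).smul
        (inv_nonneg.2 (hA0 0 0).le)
      convert this using 1
      ext i j
      simp [hZdef, Matrix.vecMulVec_apply, hs 0 j]
      ring
    -- On the segment from the rank-one `Z` to `A`, convexity keeps the entries positive and the
    -- matrices semidefinite.
    have hAZ : ∀ t : ℝ, Z + t • B = (1 - t) • Z + t • A := by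
      intro t
      ext i j
      simp [hZdef, hBdef]
      ring
    have hpos : ∀ t ∈ Set.Icc (0 : ℝ) 1, ∀ i j, 0 < (Z + t • B) i j := by
      intro t ht i j
      rw [hAZ]
      simp only [Matrix.add_apply, Matrix.smul_apply, smul_eq_mul]
      rcases eq_or_lt_of_le ht.2 with rfl | h1
      · simpa using hA0 i j
      · exact add_pos_of_pos_of_nonneg (mul_pos (sub_pos.2 h1) (hZ0 i j))
          (mul_nonneg ht.1 (hA0 i j).le)
    have hpsd : ∀ t ∈ Set.Icc (0 : ℝ) 1, (Z + t • B).PosSemidef := by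
      intro t ht
      rw [hAZ]
      exact (hZ.smul (sub_nonneg.2 ht.2)).add (hA.smul ht.1)
    refine Matrix.PosSemidef.of_dotProduct_mulVec_nonneg ?_ fun v => ?_
    · ext i j
      simp [hs i j]
    set φ : ℝ → ℝ := fun t => ∑ i, ∑ j, v i * v j * (Z i j + t * B i j) ^ α with hφ
    set φ' : ℝ → ℝ := fun t => ∑ i, ∑ j, v i * v j *
      (B i j * α * (Z i j + t * B i j) ^ (α - 1)) with hφ'
    have hd : ∀ t ∈ Set.Icc (0 : ℝ) 1, HasDerivAt φ (φ' t) t := by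
      intro t ht
      refine HasDerivAt.fun_sum fun i _ => HasDerivAt.fun_sum fun j _ => ?_
      have h1 : HasDerivAt (fun t => Z i j + t * B i j) (B i j) t := by
        simpa using ((hasDerivAt_id t).mul_const (B i j)).const_add (Z i j)
      exact (h1.rpow_const (Or.inl (by simpa using (hpos t ht i j).ne'))).const_mul _
    -- The derivative is the form of `α` times the Hadamard product of `B` with the power `α - 1`.
    -- As `B` vanishes in row and column 0, only the block of order one less matters, where
    -- induction and the Schur product theorem apply.
    have hd0 : ∀ t ∈ Set.Icc (0 : ℝ) 1, 0 ≤ φ' t := by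
      intro t ht
      have hB0 : ∀ j, B 0 j = 0 := fun j => by
        have := (hA0 0 0).ne'
        simp only [hBdef, Matrix.of_apply]; field_simp; ring
      have hB0' : ∀ i, B i 0 = 0 := fun i => by
        have := (hA0 0 0).ne'
        simp only [hBdef, Matrix.of_apply]; field_simp; ring
      have h1 := (hB.submatrix Fin.succ).hadamard (ih (α - 1) (by push_cast at hα; linarith)
        ((Z + t • B).submatrix Fin.succ Fin.succ) ((hpsd t ht).submatrix Fin.succ)
        (fun i j => hpos t ht _ _))
      have h2 := mul_nonneg hα0 (h1.dotProduct_mulVec_nonneg (fun i => v i.succ))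
      refine h2.trans_eq (Eq.symm ?_)
      simp only [hφ']
      rw [Fin.sum_univ_succ]
      simp only [Fin.sum_univ_succ (n := m + 1), hB0, hB0']
      simp only [dotProduct, Matrix.mulVec, Finset.mul_sum]
      simp
      refine Finset.sum_congr rfl fun i _ => Finset.sum_congr rfl fun j _ => ?_
      ring
    have hmono : MonotoneOn φ (Set.Icc 0 1) := by
      refine monotoneOn_of_deriv_nonneg (convex_Icc 0 1)
        (fun t ht => (hd t ht).continuousAt.continuousWithinAt) ?_ ?_
      · intro t ht
        exact (hd t (interior_subset ht)).differentiableAt.differentiableWithinAt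
      · intro t ht
        rw [(hd t (interior_subset ht)).deriv]
        exact hd0 t (interior_subset ht)
    have h01 := hmono (Set.left_mem_Icc.2 zero_le_one) (Set.right_mem_Icc.2 zero_le_one) zero_le_one
    have hφ0 : φ 0 = (∑ i, v i * A i 0 ^ α) ^ 2 / A 0 0 ^ α := by
      simp only [hφ, zero_mul, add_zero, sq, Finset.sum_mul_sum, Finset.sum_div]
      refine Finset.sum_congr rfl fun i _ => Finset.sum_congr rfl fun j _ => ?_
      simp only [hZdef, Matrix.of_apply]
      rw [Real.div_rpow (mul_pos (hA0 _ _) (hA0 _ _)).le (hA0 _ _).le,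
        Real.mul_rpow (hA0 _ _).le (hA0 _ _).le, hs 0 j]
      ring
    have hφ1 : φ 1 = star v ⬝ᵥ (A.map (· ^ α)).mulVec v := by
      simp only [hφ, dotProduct, Matrix.mulVec, Finset.mul_sum]
      refine Finset.sum_congr rfl fun i _ => Finset.sum_congr rfl fun j _ => ?_
      simp [hZdef, hBdef]
      ring
    rw [← hφ1]
    refine le_trans ?_ h01
    rw [hφ0]
    exact div_nonneg (sq_nonneg _) (Real.rpow_nonneg (hA0 _ _).le _)

theorem Matrix.PosSemidef.map_pow {n : ℕ} {A : Matrix (Fin n) (Fin n) ℝ} (hA : A.PosSemidef)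
    (k : ℕ) : (A.map (· ^ k)).PosSemidef := by
  induction k with
  | zero =>
    have := Matrix.posSemidef_vecMulVec_self_star (fun _ : Fin n => (1 : ℝ))
    convert this using 1
    ext i j
    simp [Matrix.vecMulVec_apply]
  | succ k ih =>
    have : A.map (· ^ (k + 1)) = (A.map (· ^ k)).hadamard A := by
      ext i j
      simp [pow_succ]
    rw [this]
    exact ih.hadamard hA

/-! ### Continuous Hankel kernels: total non-negativity from semidefiniteness -/

open Filter Topology in
theorem det_hankel_nonneg {p N₁ N₂ : ℕ} (s : ℕ → ℝ)
    (h : ∀ r ≤ p, ∀ c, c + 2 * r ≤ N₁ + N₂ →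
      (Matrix.of fun i j : Fin r => s (c + i + j)).PosSemidef)
    (r : ℕ) (hr : r ≤ p) (I J : Fin r → ℕ) (hI : StrictMono I) (hJ : StrictMono J)
    (hI' : ∀ a, I a < N₁) (hJ' : ∀ a, J a < N₂) :
    0 ≤ (Matrix.of fun a b : Fin r => s (I a + J b)).det := by
  -- Moments of `p` distinct positive atoms: by Vandermonde, all shifted Hankel matrices of order at
  -- most `p` are positive definite. The atoms are squares, so that odd shifts also factor as a Gram
  -- matrix.
  set g : ℕ → ℝ := fun n => ∑ m : Fin p, ((m : ℝ) + 1) ^ (2 * n) with hg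
  have hgpd : ∀ r ≤ p, ∀ c, (Matrix.of fun i j : Fin r => g (c + i + j)).PosDef := by
    intro r hr c
    have hinj : Function.Injective
        (Matrix.of fun (m : Fin p) (i : Fin r) => ((m : ℝ) + 1) ^ (c + 2 * (i : ℕ))).mulVec := by
      refine (injective_iff_map_eq_zero (Matrix.mulVecLin _)).2 fun v hv => ?_
      refine Matrix.eq_zero_of_forall_index_sum_pow_mul_eq_zero
        (f := fun m : Fin r => ((m : ℝ) + 1) ^ 2) ?_ ?_
      · intro a b hab
        have := (pow_left_inj₀ (by positivity) (by positivity) two_ne_zero).1 hab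
        ext
        exact_mod_cast (add_right_cancel this)
      · intro m
        have h1 := congrFun hv (m.castLE hr)
        simp only [Matrix.mulVecLin_apply, Matrix.mulVec, dotProduct, Matrix.of_apply, Fin.val_castLE, pow_add, mul_assoc,
          ← Finset.mul_sum, Pi.zero_apply, pow_mul] at h1
        exact (mul_eq_zero.1 h1).resolve_left (by positivity)
    convert Matrix.PosDef.conjTranspose_mul_self _ hinj using 1
    ext i j
    simp only [hg, Matrix.mul_apply, Matrix.of_apply, Matrix.conjTranspose_apply, star_trivial]
    refine Finset.sum_congr rfl fun m _ => ?_
    rw [← pow_add]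
    congr 1
    ring
  have hpos : ∀ ε : ℝ, 0 < ε →
      0 < (Matrix.of fun a b : Fin r => s (I a + J b) + ε * g (I a + J b)).det := by
    intro ε hε
    refine Matrix.det_pos_of_consecutive (p := p) (N₁ := N₁) (N₂ := N₂)
      (fun i j => s (i + j) + ε * g (i + j)) ?_ r hr I J hI hJ hI' hJ'
    intro q hq i j hi hj
    have h1 := ((hgpd q hq (i + j)).smul hε).posSemidef_add (h q hq (i + j) (by omega))
    refine h1.det_pos.trans_eq (congrArg Matrix.det ?_)
    ext a b
    simp only [Matrix.add_apply, Matrix.smul_apply, Matrix.of_apply, smul_eq_mul]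
    rw [show i + (a : ℕ) + (j + b) = i + j + a + b by ring]
  have hcont : Continuous fun ε : ℝ =>
      (Matrix.of fun a b : Fin r => s (I a + J b) + ε * g (I a + J b)).det := by
    refine Continuous.matrix_det ?_
    refine continuous_matrix fun a b => ?_
    simp only [Matrix.of_apply]
    fun_prop
  have hlim := (hcont.tendsto 0).mono_left (nhdsWithin_le_nhds (s := Set.Ioi 0))
  simp only [zero_mul, add_zero] at hlim
  refine ge_of_tendsto hlim ?_
  filter_upwards [self_mem_nhdsWithin] with ε hε
  exact (hpos ε hε).le

theorem IsTNOrder.mono {X Y : Type*} [LinearOrder X] [LinearOrder Y] {p q : ℕ} {K : X → Y → ℝ}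
    (h : IsTNOrder p K) (hqp : q ≤ p) : IsTNOrder q K :=
  fun r hr hrq => h r hr (hrq.trans hqp)

theorem IsTNOrder.nonneg {X Y : Type*} [LinearOrder X] [LinearOrder Y] {p : ℕ} {K : X → Y → ℝ}
    (h : IsTNOrder p K) (hp : 1 ≤ p) (x : X) (y : Y) : 0 ≤ K x y := by
  simpa using h 1 le_rfl hp (fun _ => x) (Subsingleton.strictMono _) (fun _ => y)
    (Subsingleton.strictMono _)

theorem IsHankel.symm {X : Set ℝ} {H : X → X → ℝ} (hH : IsHankel H) (x y : X) : H x y = H y x := by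
  obtain ⟨f, hf⟩ := hH
  rw [hf, hf, add_comm]

theorem IsHankel.kernelPow {X : Set ℝ} {H : X → X → ℝ} (hH : IsHankel H) (α : ℝ) :
    IsHankel (kernelPow H α) := by
  obtain ⟨f, hf⟩ := hH
  exact ⟨fun t => if f t = 0 then 0 else f t ^ α, fun x y => by simp [_root_.kernelPow, hf]⟩

open Filter Topology in
/-- A continuous `TN₂` Hankel kernel on an interval vanishing at one point vanishes identically. -/
theorem IsHankel.eq_zero_of_eq_zero {X : Set ℝ} (hX : X.OrdConnected) {H : X → X → ℝ}
    (hH : IsHankel H) (hc : Continuous (Function.uncurry H)) (h2 : IsTNOrder 2 H) {x₀ y₀ : X}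
    (h0 : H x₀ y₀ = 0) (x y : X) : H x y = 0 := by
  -- The principal 2 × 2 minor at `z`, `w` equals `-H(z,w)^2`.
  have hrow : ∀ z w : X, H z z = 0 → H z w = 0 := by
    intro z w hz
    wlog hzw : z < w generalizing z w
    · rcases (not_lt.1 hzw).eq_or_lt with rfl | hlt
      · exact hz
      · have h1 := h2 2 (by norm_num) le_rfl ![w, z] (by simpa [Fin.strictMono_iff_lt_succ] using hlt)
          ![w, z] (by simpa [Fin.strictMono_iff_lt_succ] using hlt)
        rw [Matrix.det_fin_two] at h1
        simp [hz, hH.symm w z] at h1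
        nlinarith
    · have h1 := h2 2 (by norm_num) le_rfl ![z, w] (by simpa [Fin.strictMono_iff_lt_succ] using hzw)
        ![z, w] (by simpa [Fin.strictMono_iff_lt_succ] using hzw)
      rw [Matrix.det_fin_two] at h1
      simp [hz, hH.symm w z] at h1
      nlinarith
  obtain ⟨f, hf⟩ := hH
  have hmid : ∀ x y : X, ∃ z : X, (z : ℝ) + z = x + y := by
    intro x y
    refine ⟨⟨((x : ℝ) + y) / 2, ?_⟩, by simp⟩
    rcases le_total (x : ℝ) y with h | h
    · exact hX.out x.2 y.2 ⟨by linarith, by linarith⟩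
    · exact hX.out y.2 x.2 ⟨by linarith, by linarith⟩
  have hdiag : ∀ z w : X, H z z = 0 → H w w = 0 := by
    intro z w hz
    have hmem : ∀ n : ℕ, (w : ℝ) + (z - w) * (1 / 2) ^ n ∈ X := by
      intro n
      have h1 : (0 : ℝ) ≤ (1 / 2) ^ n := by positivity
      have h2 : ((1 : ℝ) / 2) ^ n ≤ 1 := pow_le_one₀ (by norm_num) (by norm_num)
      rcases le_total (z : ℝ) w with h | h
      · exact hX.out z.2 w.2 ⟨by nlinarith, by nlinarith⟩
      · exact hX.out w.2 z.2 ⟨by nlinarith, by nlinarith⟩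
    -- Each point is the midpoint of its predecessor and `w`, so the Hankel property carries the
    -- zero along; continuity carries it to the limit `w`.
    set u : ℕ → X := fun n => ⟨_, hmem n⟩ with hu
    have hu0 : ∀ n, H (u n) (u n) = 0 := by
      intro n
      induction n with
      | zero =>
        have : u 0 = z := by ext; simp [hu]
        rw [this, hz]
      | succ n ih =>
        have := hrow _ w ih
        rw [hf] at this ⊢
        rw [← this]
        congr 1
        simp only [hu]
        ring
    have hlim : Tendsto u atTop (𝓝 w) := by
      rw [tendsto_subtype_rng]
      have := (tendsto_pow_atTop_nhds_zero_of_lt_one (r := (1 / 2 : ℝ)) (by norm_num)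
        (by norm_num)).const_mul ((z : ℝ) - w) |>.const_add (w : ℝ)
      simpa [hu] using this
    have h3 := (hc.tendsto (w, w)).comp (hlim.prodMk_nhds hlim)
    refine tendsto_nhds_unique h3 ?_
    simp [Function.comp_def, Function.uncurry, hu0]
  obtain ⟨z, hz⟩ := hmid x₀ y₀
  obtain ⟨w, hw⟩ := hmid x y
  rw [hf, ← hw, ← hf]
  refine hdiag z w ?_
  rw [hf, hz, ← hf, h0]

-- Rounding down to the mesh `1/N` keeps the points between `x 0` and `x j`, hence in `X`. A mesh
-- shared by rows and columns makes the sampled kernel a Hankel matrix.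
open Filter Topology in
theorem exists_grid_approx {X : Set ℝ} (hX : X.OrdConnected) {n : ℕ} (x : Fin (n + 1) → X)
    (hx : StrictMono x) :
    ∃ u : ℕ → Fin (n + 1) → X, (∀ j, Tendsto (fun N => u N j) atTop (𝓝 (x j))) ∧
      (∀ N j, (u N j : ℝ) = x 0 + (⌊((x j : ℝ) - x 0) * N⌋₊ : ℝ) / N) ∧
      ∀ᶠ N : ℕ in atTop, StrictMono fun j => ⌊((x j : ℝ) - x 0) * N⌋₊ := by
  have h0 : ∀ j, (0 : ℝ) ≤ (x j : ℝ) - x 0 := fun j => sub_nonneg.2 (hx.monotone (Fin.zero_le j))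
  have hlim : ∀ j, Tendsto (fun N : ℕ => (⌊((x j : ℝ) - x 0) * N⌋₊ : ℝ) / N) atTop
      (𝓝 ((x j : ℝ) - x 0)) := fun j =>
    (tendsto_nat_floor_mul_div_atTop (h0 j)).comp tendsto_natCast_atTop_atTop
  have hle : ∀ (N : ℕ) j, (⌊((x j : ℝ) - x 0) * N⌋₊ : ℝ) / N ≤ (x j : ℝ) - x 0 := by
    intro N j
    exact div_le_of_le_mul₀ N.cast_nonneg (h0 j)
      (Nat.floor_le (mul_nonneg (h0 j) N.cast_nonneg))
  refine ⟨fun N j => ⟨x 0 + (⌊((x j : ℝ) - x 0) * N⌋₊ : ℝ) / N,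
    hX.out (x 0).2 (x j).2 ⟨?_, ?_⟩⟩, ?_, fun _ _ => rfl, ?_⟩
  · have : (0 : ℝ) ≤ (⌊((x j : ℝ) - x 0) * N⌋₊ : ℝ) / N := by positivity
    linarith
  · linarith [hle N j]
  · intro j
    rw [tendsto_subtype_rng]
    simpa using (hlim j).const_add (x 0 : ℝ)
  · have : ∀ i j, ∀ᶠ N : ℕ in atTop, i < j →
        ⌊((x i : ℝ) - x 0) * N⌋₊ < ⌊((x j : ℝ) - x 0) * N⌋₊ := by
      intro i j
      by_cases hij : i < j
      · have hlt : (x i : ℝ) - x 0 < (x j : ℝ) - x 0 := sub_lt_sub_right (Subtype.coe_lt_coe.2 (hx hij)) _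
        filter_upwards [(hlim i).eventually_lt (hlim j) hlt, eventually_gt_atTop 0] with N hN hN0 _
        have hN0' : (0 : ℝ) < N := by exact_mod_cast hN0
        rw [div_lt_div_iff_of_pos_right hN0'] at hN
        exact_mod_cast hN
      · simp [hij]
    filter_upwards [eventually_all.2 fun i => eventually_all.2 (this i)] with N hN i j hij
    exact hN i j hij

open Filter Topology in
/-- A continuous Hankel kernel on an interval whose principal submatrices of order at most `p` are
positive semidefinite is `TN_p`. -/
theorem IsHankel.isTNOrder_of_posSemidef {p : ℕ} {X : Set ℝ} (hX : X.OrdConnected)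
    {H : X → X → ℝ} (hH : IsHankel H) (hc : Continuous (Function.uncurry H))
    (hpsd : ∀ r ≤ p, ∀ z : Fin r → X, StrictMono z →
      (Matrix.of fun i j => H (z i) (z j)).PosSemidef) : IsTNOrder p H := by
  intro r hr hrp x hx y hy
  obtain ⟨n, rfl⟩ : ∃ n, r = n + 1 := ⟨r - 1, by omega⟩
  obtain ⟨f, hf⟩ := hH
  obtain ⟨u, hu, hu', huI⟩ := exists_grid_approx hX x hx
  obtain ⟨v, hv, hv', hvJ⟩ := exists_grid_approx hX y hy
  have hlim : Tendsto (fun N => (Matrix.of fun j k => H (u N j) (v N k)).det) atTop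
      (𝓝 (Matrix.of fun j k => H (x j) (y k)).det) := by
    refine ((continuous_id.matrix_det).tendsto _).comp ?_
    refine tendsto_pi_nhds.2 fun j => tendsto_pi_nhds.2 fun k => ?_
    exact (hc.tendsto (x j, y k)).comp ((hu j).prodMk_nhds (hv k))
  refine ge_of_tendsto hlim ?_
  filter_upwards [huI, hvJ, eventually_gt_atTop 0] with N hI hJ hN
  have hN' : (0 : ℝ) < N := by exact_mod_cast hN
  set I : Fin (n + 1) → ℕ := fun j => ⌊((x j : ℝ) - x 0) * N⌋₊ with hIdef
  set J : Fin (n + 1) → ℕ := fun j => ⌊((y j : ℝ) - y 0) * N⌋₊ with hJdef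
  have key := det_hankel_nonneg (p := p) (N₁ := I (Fin.last n) + 1) (N₂ := J (Fin.last n) + 1)
    (fun m => f ((x 0 : ℝ) + y 0 + m / N)) ?_ (n + 1) hrp I J hI hJ
    (fun a => Nat.lt_succ_of_le (hI.monotone (Fin.le_last a)))
    (fun a => Nat.lt_succ_of_le (hJ.monotone (Fin.le_last a)))
  · refine key.trans_eq (congrArg Matrix.det ?_)
    ext j k
    simp only [Matrix.of_apply, hf, hu', hv']
    congr 1
    push_cast
    ring
  · intro q hq c hcq
    have hz0 : ∀ t : ℝ, 0 ≤ t → 2 * t ≤ I (Fin.last n) + J (Fin.last n) →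
        ((x 0 : ℝ) + y 0) / 2 + t / N ∈ X := by
      intro t ht ht'
      have hA := hu' N (Fin.last n)
      have hB := hv' N (Fin.last n)
      have h1 : t / N ≤ (I (Fin.last n) / N + J (Fin.last n) / N) / 2 := by
        rw [← add_div, div_div, mul_comm, ← div_div]
        exact div_le_div_of_nonneg_right (by linarith) hN'.le
      have h2 : 0 ≤ t / N := by positivity
      have hmid : ∀ a b : X, ((a : ℝ) + b) / 2 ∈ X := by
        intro a b
        rcases le_total (a : ℝ) b with h | h
        · exact hX.out a.2 b.2 ⟨by linarith, by linarith⟩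
        · exact hX.out b.2 a.2 ⟨by linarith, by linarith⟩
      refine hX.out (hmid (x 0) (y 0)) (hmid (u N (Fin.last n)) (v N (Fin.last n))) ⟨?_, ?_⟩
      · linarith
      · rw [hA, hB]
        linarith
    -- Splitting the offset `c` evenly between rows and columns makes the block principal, at nodes
    -- between the midpoints of the first and of the last grid points.
    have hz : ∀ i : Fin q, ((x 0 : ℝ) + y 0) / 2 + ((c : ℝ) / 2 + i) / N ∈ X := by
      intro i
      refine hz0 _ (by positivity) ?_
      have : c + 2 * (i : ℕ) ≤ I (Fin.last n) + J (Fin.last n) := by have := i.2; omega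
      have : (c : ℝ) + 2 * (i : ℕ) ≤ I (Fin.last n) + J (Fin.last n) := by exact_mod_cast this
      linarith
    convert hpsd q hq (fun i => ⟨_, hz i⟩) ?_ using 1
    · ext i j
      simp only [Matrix.of_apply, hf]
      congr 1
      push_cast
      field_simp
      ring
    · intro i j hij
      have : (i : ℝ) < j := by exact_mod_cast hij
      change ((x 0 : ℝ) + y 0) / 2 + ((c : ℝ) / 2 + i) / N < (x 0 + y 0) / 2 + ((c : ℝ) / 2 + j) / N
      gcongr

theorem IsTNOrder.posSemidef {p : ℕ} {X : Set ℝ} {H : X → X → ℝ} (h : IsTNOrder p H)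
    (hH : IsHankel H) {r : ℕ} (hr : r ≤ p) {z : Fin r → X} (hz : StrictMono z) :
    (Matrix.of fun i j => H (z i) (z j)).PosSemidef := by
  refine Matrix.posSemidef_of_principal_minors_nonneg _ ?_ ?_
  · ext i j
    simp [hH.symm (z i) (z j)]
  · intro k e he
    rcases Nat.eq_zero_or_pos k with rfl | hk
    · simp
    · have hkr : k ≤ r := by simpa using Fintype.card_le_of_injective e he.injective
      exact h k hk (hkr.trans hr) (z ∘ e) (hz.comp he) (z ∘ e) (hz.comp he)

/-! ### Powers of Hankel kernels, the critical kernel and the equivalence -/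

theorem IsHankel.isTNOrder_kernelPow {p : ℕ} (hp : 2 ≤ p) {X : Set ℝ} (hX : X.OrdConnected)
    {H : X → X → ℝ} (hH : IsHankel H) (hc : Continuous (Function.uncurry H)) (h : IsTNOrder p H)
    {α : ℝ} (hα : α ∈ Set.range (fun n : ℕ => (n : ℝ)) ∪ Set.Ici ((p : ℝ) - 2)) :
    IsTNOrder p (_root_.kernelPow H α) := by
  by_cases h0 : ∃ x y, H x y = 0
  · obtain ⟨x₀, y₀, h0⟩ := h0
    have hz := hH.eq_zero_of_eq_zero hX hc (h.mono hp) h0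
    intro r hr _ x _ y _
    have : (Matrix.of fun j k => _root_.kernelPow H α (x j) (y k)) = 0 := by
      ext j k
      simp [_root_.kernelPow, hz]
    have : Nonempty (Fin r) := ⟨⟨0, hr⟩⟩
    simp [*]
  push Not at h0
  have hpos : ∀ x y, 0 < H x y := fun x y => (h.nonneg (by omega) x y).lt_of_ne' (h0 x y)
  have hpow : _root_.kernelPow H α = fun x y => H x y ^ α := by
    ext x y
    simp [_root_.kernelPow, h0]
  refine (hH.kernelPow α).isTNOrder_of_posSemidef hX ?_ ?_
  · rw [hpow]
    exact hc.rpow_const fun q => Or.inl (h0 q.1 q.2)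
  · intro r hr z hz
    have hA := h.posSemidef hH hr hz
    rw [hpow]
    rcases hα with ⟨n, rfl⟩ | hα
    · convert hA.map_pow n using 1
      ext i j
      simp
    · rcases r with _ | m
      · rw [Subsingleton.elim (Matrix.of _) 0]
        exact Matrix.PosSemidef.zero
      · refine Matrix.PosSemidef.map_rpow m α ?_ _ hA (fun i j => hpos _ _)
        have : ((m + 1 : ℕ) : ℝ) ≤ p := by exact_mod_cast hr
        push_cast at this
        have := Set.mem_Ici.1 hα
        linarith

theorem exists_det_kernelPow_expHankel_eq {c₀ u₀ : ℝ} (hc₀ : 0 < c₀) (hu₀ : 0 < u₀) (hu₀' : u₀ ≠ 1)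
    (α : ℝ) {X : Set ℝ} {n : ℕ} {x y : Fin (n + 1) → X} (hx : StrictMono x) (hy : StrictMono y) :
    ∃ C : ℝ, 0 < C ∧ (Matrix.of fun j k => kernelPow (expHankel c₀ u₀ X) α (x j) (y k)).det =
      C * ∏ i ∈ Finset.range n, (α - i) ^ (n - i) := by
  have hk : ∀ a b : X, kernelPow (expHankel c₀ u₀ X) α a b =
      (1 + c₀ * u₀ ^ (a : ℝ) * u₀ ^ (b : ℝ)) ^ α := by
    intro a b
    have h1 : expHankel c₀ u₀ X a b = 1 + c₀ * u₀ ^ (a : ℝ) * u₀ ^ (b : ℝ) := by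
      rw [expHankel, Real.rpow_add hu₀, mul_assoc]
    have h2 : 0 < 1 + c₀ * u₀ ^ (a : ℝ) * u₀ ^ (b : ℝ) := by positivity
    rw [kernelPow, h1, if_neg h2.ne']
  simp only [hk]
  rcases hu₀'.lt_or_gt with hlt | hgt
  -- For `u₀ < 1` the exponential decreases; reversing rows and columns together restores the order
  -- without changing the determinant.
  · have h1 : ∀ z : Fin (n + 1) → X, StrictMono z →
        StrictMono fun j => u₀ ^ (z (Fin.rev j) : ℝ) := fun z hz i j hij =>
      Real.rpow_lt_rpow_of_exponent_gt hu₀ hlt (hz (Fin.rev_lt_rev.2 hij))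
    obtain ⟨C, hC, hC'⟩ := Matrix.exists_det_one_add_mul_rpow_eq n α
      (fun j => c₀ * u₀ ^ (x (Fin.rev j) : ℝ)) (fun j => u₀ ^ (y (Fin.rev j) : ℝ))
      (fun i j hij => mul_lt_mul_of_pos_left (h1 x hx hij) hc₀) (h1 y hy)
      (fun _ => by positivity) (fun _ => by positivity)
    refine ⟨C, hC, ?_⟩
    rw [← hC', ← Matrix.det_submatrix_equiv_self Fin.revPerm]
    rfl
  · have h1 : ∀ z : Fin (n + 1) → X, StrictMono z →
        StrictMono fun j => u₀ ^ (z j : ℝ) := fun z hz i j hij =>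
      Real.rpow_lt_rpow_of_exponent_lt hgt (hz hij)
    exact Matrix.exists_det_one_add_mul_rpow_eq n α
      (fun j => c₀ * u₀ ^ (x j : ℝ)) (fun j => u₀ ^ (y j : ℝ))
      (fun i j hij => mul_lt_mul_of_pos_left (h1 x hx hij) hc₀) (h1 y hy)
      (fun _ => by positivity) (fun _ => by positivity)

theorem IsPosInterval.exists_strictMono {X : Set ℝ} (hX : IsPosInterval X) (p : ℕ) :
    ∃ x : Fin p → X, StrictMono x := by
  have hnt : X.Nontrivial := by
    by_contra h
    exact hX.2.ne' ((Set.not_nontrivial_iff.1 h).measure_zero _)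
  obtain ⟨a, ha, b, hb, hab⟩ := hnt.exists_lt
  have hmem : ∀ i : Fin p, a + (b - a) * (i / p) ∈ X := by
    intro i
    have h0 : (0 : ℝ) ≤ i / p := by positivity
    have h1 : (i : ℝ) / p ≤ 1 := div_le_one_of_le₀ (by exact_mod_cast i.2.le) (by positivity)
    exact hX.1.out ha hb ⟨by nlinarith, by nlinarith⟩
  refine ⟨fun i => ⟨_, hmem i⟩, fun i j hij => ?_⟩
  have hp : (0 : ℝ) < p := by exact_mod_cast (Nat.zero_le _).trans_lt i.2
  have hij' : (i : ℝ) < j := by exact_mod_cast hij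
  change a + (b - a) * (i / p) < a + (b - a) * (j / p)
  have := sub_pos.2 hab
  gcongr

theorem isTNOrder_expHankel {c₀ u₀ : ℝ} (hc₀ : 0 < c₀) (hu₀ : 0 < u₀) (hu₀' : u₀ ≠ 1) (p : ℕ)
    (X : Set ℝ) : IsTNOrder p (expHankel c₀ u₀ X) := by
  intro r hr _ x hx y hy
  obtain ⟨n, rfl⟩ : ∃ n, r = n + 1 := ⟨r - 1, by omega⟩
  obtain ⟨C, hC, hC'⟩ := exists_det_kernelPow_expHankel_eq hc₀ hu₀ hu₀' 1 hx hy
  have h1 : ∀ a b, kernelPow (expHankel c₀ u₀ X) 1 a b = expHankel c₀ u₀ X a b := by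
    intro a b
    simp only [kernelPow, Real.rpow_one]
    split_ifs with h
    · exact h.symm
    · rfl
  simp only [h1] at hC'
  rw [hC']
  refine mul_nonneg hC.le ?_
  by_cases hn : 2 ≤ n
  -- At `α = 1` the factor with `i = 1` kills every minor of order at least 3, as the kernel has
  -- rank 2.
  · refine (Finset.prod_eq_zero (i := 1) (Finset.mem_range.2 (by omega)) ?_).ge
    simp
    omega
  · refine Finset.prod_nonneg fun i hi => ?_
    obtain rfl : i = 0 := by have := Finset.mem_range.1 hi; omega
    simp

theorem isTPOrder_kernelPow_expHankel {c₀ u₀ : ℝ} (hc₀ : 0 < c₀) (hu₀ : 0 < u₀) (hu₀' : u₀ ≠ 1)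
    {p : ℕ} {α : ℝ} (hα : (p : ℝ) - 2 < α) {X : Set ℝ} {x y : Fin p → X} (hx : StrictMono x)
    (hy : StrictMono y) :
    IsTPOrder p (fun j k : Fin p => kernelPow (expHankel c₀ u₀ X) α (x j) (y k)) := by
  intro r hr hrp ι hι κ hκ
  obtain ⟨n, rfl⟩ : ∃ n, r = n + 1 := ⟨r - 1, by omega⟩
  obtain ⟨C, hC, hC'⟩ := exists_det_kernelPow_expHankel_eq hc₀ hu₀ hu₀' α (hx.comp hι) (hy.comp hκ)
  refine hC'.symm ▸ mul_pos hC (Finset.prod_pos fun i hi => pow_pos ?_ _)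
  have h1 : i + 2 ≤ p := by have := Finset.mem_range.1 hi; omega
  have h2 : (i : ℝ) + 2 ≤ p := by exact_mod_cast h1
  linarith

theorem not_isTNOrder_kernelPow_expHankel {c₀ u₀ : ℝ} (hc₀ : 0 < c₀) (hu₀ : 0 < u₀) (hu₀' : u₀ ≠ 1)
    {p : ℕ} {α : ℝ} (hα : α ∈ Set.Ioo (0 : ℝ) ((p : ℝ) - 2) \ Set.range (fun m : ℤ => (m : ℝ)))
    {X : Set ℝ} {x y : Fin p → X} (hx : StrictMono x) (hy : StrictMono y) :
    ¬ IsTNOrder p (fun j k : Fin p => kernelPow (expHankel c₀ u₀ X) α (x j) (y k)) := by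
  intro h
  obtain ⟨⟨hα0, hαp⟩, hαZ⟩ := hα
  set n := ⌊α⌋₊ with hn
  have hnα : (n : ℝ) < α := (Nat.floor_le hα0.le).lt_of_ne fun h => hαZ ⟨n, by simpa using h⟩
  have hαn : α < n + 1 := Nat.lt_floor_add_one α
  -- In order `⌊α⌋ + 3` exactly one factor is negative, `α - (⌊α⌋ + 1)`, and it has exponent 1.
  have hnp : n + 2 + 1 ≤ p := by
    have : (n : ℝ) + 2 < p := by linarith
    have : n + 2 < p := by exact_mod_cast this
    omega
  have hs := Fin.strictMono_castLE hnp
  obtain ⟨C, hC, hC'⟩ := exists_det_kernelPow_expHankel_eq hc₀ hu₀ hu₀' α (hx.comp hs) (hy.comp hs)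
  refine (h (n + 2 + 1) (by omega) hnp _ hs _ hs).not_gt (hC'.trans_lt ?_)
  rw [Finset.prod_range_succ]
  refine mul_neg_of_pos_of_neg hC (mul_neg_of_pos_of_neg (Finset.prod_pos fun i hi => pow_pos ?_ _) ?_)
  · have h1 : i ≤ n := by have := Finset.mem_range.1 hi; omega
    have h2 : (i : ℝ) ≤ n := by exact_mod_cast h1
    linarith
  · rw [show n + 2 - (n + 1) = 1 by omega, pow_one]
    push_cast
    linarith

theorem theoremB (p : ℕ) (hp : 2 ≤ p) (c₀ u₀ : ℝ) (hc₀ : 0 < c₀) (hu₀ : 0 < u₀) (hu₀' : u₀ ≠ 1)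
    (α : ℝ) (hα : 0 ≤ α) (X₀ : Set ℝ) (hX₀ : IsPosInterval X₀) :
    List.TFAE
      [∀ (X : Set ℝ) (H : X → X → ℝ), IsPosInterval X → IsHankel H →
          Continuous (Function.uncurry H) → IsTNOrder p H → IsTNOrder p (kernelPow H α),
        IsTNOrder p (kernelPow (expHankel c₀ u₀ X₀) α),
        α ∈ Set.range (fun n : ℕ => (n : ℝ)) ∪ Set.Ici ((p : ℝ) - 2)] ∧
    (∀ (n : ℕ) (X : Set ℝ) (H : X → X → ℝ), IsPosInterval X → IsHankel H →
      Continuous (Function.uncurry H) → IsTN H → IsTN (kernelPow H (n : ℝ))) ∧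
    (∀ x y : Fin p → X₀, StrictMono x → StrictMono y →
      ((p : ℝ) - 2 < α →
        IsTPOrder p (fun j k : Fin p => kernelPow (expHankel c₀ u₀ X₀) α (x j) (y k))) ∧
      (α ∈ Set.Ioo (0 : ℝ) ((p : ℝ) - 2) \ Set.range (fun m : ℤ => (m : ℝ)) →
        ¬ IsTNOrder p (fun j k : Fin p => kernelPow (expHankel c₀ u₀ X₀) α (x j) (y k)))) := by
  refine ⟨?_, ?_, fun x y hx hy => ⟨fun hα => isTPOrder_kernelPow_expHankel hc₀ hu₀ hu₀' hα hx hy,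
    fun hα => not_isTNOrder_kernelPow_expHankel hc₀ hu₀ hu₀' hα hx hy⟩⟩
  · tfae_have 1 → 2 := fun h => by
      refine h X₀ _ hX₀ ⟨fun t => 1 + c₀ * u₀ ^ t, fun _ _ => rfl⟩ ?_
        (isTNOrder_expHankel hc₀ hu₀ hu₀' p X₀)
      have : Continuous fun q : X₀ × X₀ => 1 + c₀ * u₀ ^ ((q.1 : ℝ) + (q.2 : ℝ)) :=
        continuous_const.add (continuous_const.mul
          ((Real.continuous_const_rpow hu₀.ne').comp (by fun_prop)))
      exact this
    tfae_have 2 → 3 := fun h => by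
      by_contra hα'
      rw [Set.mem_union, not_or, Set.mem_Ici, not_le] at hα'
      obtain ⟨hα₁, hα₂⟩ := hα'
      have hα0 : 0 < α := hα.lt_of_ne fun h0 => hα₁ ⟨0, by simpa using h0⟩
      obtain ⟨x, hx⟩ := hX₀.exists_strictMono p
      refine not_isTNOrder_kernelPow_expHankel hc₀ hu₀ hu₀' ⟨⟨hα0, hα₂⟩, ?_⟩ hx hx
        fun r hr hrp ι hι κ hκ => h r hr hrp _ (hx.comp hι) _ (hx.comp hκ)
      rintro ⟨m, hm⟩
      have hm0 : 0 ≤ m := by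
        have : (0 : ℝ) ≤ (m : ℝ) := hα.trans_eq hm.symm
        exact_mod_cast this
      lift m to ℕ using hm0
      exact hα₁ ⟨m, by simpa using hm⟩
    tfae_have 3 → 1 := fun hα X H hX hH hc h => hH.isTNOrder_kernelPow hp hX.1 hc h hα
    tfae_finish
  · intro n X H hX hH hc h p _
    -- Order `p + 2` covers `p = 1`, since the vanishing argument needs 2 × 2 minors.
    exact (hH.isTNOrder_kernelPow (p := p + 2) (by omega) hX.1 hc (h (p + 2) (by omega))
      (Or.inl ⟨n, rfl⟩)).mono (by omega)
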